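/- Let $G$ be a locally compact, second countable, Hausdorff topological group. For $i=1,2$ let $\mathcal R_i=(U_i,\mathsf E_i,\mathcal H_i)$ be a principal frame: $\mathcal H_i$ is a complex separable Hilbert space, $U_i$ is a strongly continuous unitary representation of $G$ on $\mathcal H_i$, $\Sigma_i$ is a principal homogeneous (left) $G$-space, i.e. for every $x\in\Sigma_i$ the orbit map $g\mapsto g.x$ is a homeomorphism $G\to\Sigma_i$, and $\mathsf E_i:\mathcal B(\Sigma_i)\to B(\mathcal H_i)$ is a POVM with $\mathsf E_i(g.X)=U_i(g)\mathsf E_i(X)U_i(g)^*$. Assume that both frames are localizable: $\|\mathsf E_i(X)\|=1$ for every Borel set $X$ with $\mathsf E_i(X)\neq 0$. Fix points $x_i\in\Sigma_i$, identify $\Sigma_i$ with $G$ through $g\mapsto g.x_i$ (so that $x_i$ corresponds to the identity $e$), and regard $\mathsf E_i$ as a POVM on $G$ accordingly (for $\Sigma_i=G$ and $x_i=e$ nothing changes). For a POVM $\mathsf E$ and a state (positive trace class operator of trace one) $\omega$ write $\mu^{\mathsf E}_\omega(X)=\mathrm{tr}[\omega\,\mathsf E(X)]$. Let $(\omega_n)$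 and $(\rho_m)$ be localizing sequences for $\mathsf E_1$ and $\mathsf E_2$ centred at $e$, i.e. sequences of states on $\mathcal H_1$ and on $\mathcal H_2$ such that $\mu^{\mathsf E_1}_{\omega_n}\to\delta_e$ and $\mu^{\mathsf E_2}_{\rho_m}\to\delta_e$ weakly. The relative orientation observable is $$(\mathsf E_2*\mathsf E_1)(X)=\int_G d\mathsf E_1(g)\otimes U_2(g)\,\mathsf E_2(X)\,U_2(g)^*\in B(\mathcal H_1\otimes\mathcal H_2),\qquad X\in\mathcal B(G),$$ where for $A\in B(\mathcal H_2)$ the integral $\int_G d\mathsf E_1(g)\otimes U_2(g)AU_2(g)^*$ is the bounded operator whose expectation value in each product vector $\varphi\otimes\psi$ is $\int_G\langle\psi,U_2(g)AU_2(g)^*\psi\rangle\,d\langle\varphi,\mathsf E_1(g)\varphi\rangle$. For $h\in G$ put $h.\rho=U_2(h)^*\rho\,U_2(h)$ and $\Omega_{n,m}(h)=\omega_n\otimes h^{-1}.\rho_m$. Then for every $h\in G$ and all $n,m$ the set function $X\mapsto\mathrm{tr}[\Omega_{n,m}(h)\,(\mathsf E_2*\mathsf E_1)(X)]$ is a Borel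 probability measure $\mu^{\mathsf E_2*\mathsf E_1}_{\Omega_{n,m}(h)}$ on $G$, and, weakly, $$\lim_{n,m\to\infty}\mu^{\mathsf E_2*\mathsf E_1}_{\Omega_{n,m}(h)}=\delta_h .$$ -/

import Mathlib

open MeasureTheory Filter Topology
open scoped TensorProduct InnerProductSpace

noncomputable section

namespace QRF

/-- The Hilbert space tensor product: the completion of the algebraic tensor product with respect
to the inner product `⟪x ⊗ y, x' ⊗ y'⟫ = ⟪x, x'⟫ ⟪y, y'⟫`. -/
abbrev HilbertTensor (H K : Type*) [NormedAddCommGroup H] [InnerProductSpace ℂ H]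
    [NormedAddCommGroup K] [InnerProductSpace ℂ K] : Type _ :=
  UniformSpace.Completion (H ⊗[ℂ] K)

section Basics

variable {H : Type*} [NormedAddCommGroup H] [InnerProductSpace ℂ H]
variable {K : Type*} [NormedAddCommGroup K] [InnerProductSpace ℂ K]

/-- The product vector `φ ⊗ ψ` in the Hilbert space tensor product. -/
def tmul (φ : H) (ψ : K) : HilbertTensor H K :=
  ((φ ⊗ₜ[ℂ] ψ : H ⊗[ℂ] K) : UniformSpace.Completion (H ⊗[ℂ] K))

/-- The bounded operator `A ⊗ B` on the Hilbert space tensor product. -/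
def opTensor (A : H →L[ℂ] H) (B : K →L[ℂ] K) :
    HilbertTensor H K →L[ℂ] HilbertTensor H K :=
  (TensorProduct.mapL A B).completion

/-- The index set of a fixed orthonormal basis of `H`. -/
def basisIndex (H : Type*) [NormedAddCommGroup H] [InnerProductSpace ℂ H] [CompleteSpace H] :
    Set H :=
  (exists_hilbertBasis ℂ H).choose

/-- A fixed orthonormal basis of `H`. -/
def basis (H : Type*) [NormedAddCommGroup H] [InnerProductSpace ℂ H] [CompleteSpace H] :
    HilbertBasis (basisIndex H) ℂ H :=
  (exists_hilbertBasis ℂ H).choose_spec.choose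

/-- The trace `tr[T] = ∑ᵢ ⟪eᵢ, T eᵢ⟫`. For trace class `T` the series converges absolutely and
does not depend on the orthonormal basis. -/
def trace [CompleteSpace H] (T : H →L[ℂ] H) : ℂ :=
  ∑' i, ⟪basis H i, T (basis H i)⟫_ℂ

variable (H) in
/-- A (normal) state: a positive trace class operator of trace one. For a positive operator the
terms of the trace are nonnegative, so `trace op = 1` already forces their summability, that is,
that `op` is trace class. -/
structure State [CompleteSpace H] where
  op : H →L[ℂ] H
  isPositive : op.IsPositive
  trace_eq_one : trace op = 1

end Basics

/-- A positive operator valued measure on the measurable sets of `S`, with values in `B(H)`;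
the values of `toFun` on non-measurable sets are irrelevant. -/
structure POVM (S : Type*) [MeasurableSpace S] (H : Type*) [NormedAddCommGroup H]
    [InnerProductSpace ℂ H] where
  toFun : Set S → H →L[ℂ] H
  isPositive : ∀ X, MeasurableSet X → (toFun X).IsPositive
  map_univ : toFun Set.univ = 1
  hasSum_iUnion : ∀ X : ℕ → Set S, (∀ i, MeasurableSet (X i)) →
    Pairwise (Function.onFun Disjoint X) → ∀ φ ψ : H,
      HasSum (fun i => ⟪φ, toFun (X i) ψ⟫_ℂ) ⟪φ, toFun (⋃ i, X i) ψ⟫_ℂ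

namespace POVM

variable {S : Type*} [MeasurableSpace S] {S' : Type*} [MeasurableSpace S']
variable {H : Type*} [NormedAddCommGroup H] [InnerProductSpace ℂ H]

theorem map_empty_inner (E : POVM S H) (φ ψ : H) : ⟪φ, E.toFun ∅ ψ⟫_ℂ = 0 := by
  have h := E.hasSum_iUnion (fun _ => ∅) (fun _ => MeasurableSet.empty)
    (fun _ _ _ => disjoint_bot_left) φ ψ
  exact tendsto_nhds_unique tendsto_const_nhds h.summable.tendsto_atTop_zero

theorem re_nonneg (E : POVM S H) {X : Set S} (hX : MeasurableSet X) (φ : H) :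
    0 ≤ (⟪φ, E.toFun X φ⟫_ℂ).re :=
  (E.isPositive X hX).re_inner_nonneg_right φ

/-- The finite positive measure `X ↦ ⟪φ, E(X) φ⟫`. -/
def vectorMeasure (E : POVM S H) (φ : H) : Measure S :=
  Measure.ofMeasurable (fun X _ => ENNReal.ofReal (⟪φ, E.toFun X φ⟫_ℂ).re)
    (by simp [E.map_empty_inner φ φ])
    (by
      intro X hX hd
      have h := Complex.hasSum_re (E.hasSum_iUnion X hX hd φ φ)
      rw [← h.tsum_eq, ENNReal.ofReal_tsum_of_nonneg (fun i => E.re_nonneg (hX i) φ) h.summable])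

theorem vectorMeasure_apply (E : POVM S H) (φ : H) {X : Set S} (hX : MeasurableSet X) :
    E.vectorMeasure φ X = ENNReal.ofReal (⟪φ, E.toFun X φ⟫_ℂ).re :=
  Measure.ofMeasurable_apply X hX

/-- The norm-1 property. -/
def IsLocalizable (E : POVM S H) : Prop :=
  ∀ X, MeasurableSet X → E.toFun X ≠ 0 → ‖E.toFun X‖ = 1

/-- The image of a POVM under a measurable map. -/
def map (E : POVM S H) (f : S → S') (hf : Measurable f) : POVM S' H where
  toFun Y := E.toFun (f ⁻¹' Y)
  isPositive Y hY := E.isPositive _ (hf hY)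
  map_univ := by simpa using E.map_univ
  hasSum_iUnion Y hY hd φ ψ := by
    have h := E.hasSum_iUnion (fun i => f ⁻¹' (Y i)) (fun i => hf (hY i))
      (fun i j hij => (hd hij).preimage f) φ ψ
    simpa [Set.preimage_iUnion] using h

end POVM

section Born

variable {S : Type*} [MeasurableSpace S]
variable {H : Type*} [NormedAddCommGroup H] [InnerProductSpace ℂ H] [CompleteSpace H]

/-- `μ` is the probability measure that the operator valued set function `E` and the density
operator `ω` give through the Born rule: `μ(X) = tr[ω E(X)]` for all measurable `X`. -/
def IsBornMeasure (E : Set S → H →L[ℂ] H) (ω : H →L[ℂ] H) (μ : ProbabilityMeasure S) : Prop :=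
  ∀ X, MeasurableSet X → ((((μ : Measure S) X).toReal : ℝ) : ℂ) = trace (ω ∘L E X)

/-- A localizing sequence of `E` centred at `x`: a sequence of states `ω n` whose Born measures
converge weakly to the Dirac measure at `x`. -/
def IsLocalizingSequence [TopologicalSpace S] [OpensMeasurableSpace S]
    (E : POVM S H) (x : S) (ω : ℕ → State H) : Prop :=
  ∃ μ : ℕ → ProbabilityMeasure S,
    (∀ n, IsBornMeasure E.toFun (ω n).op (μ n)) ∧ Tendsto μ atTop (𝓝 (diracProba x))

end Born

section Representations

/-- A strongly continuous unitary representation of `G` on `H`. -/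
structure UnitaryRep (G : Type*) [Group G] [TopologicalSpace G]
    (H : Type*) [NormedAddCommGroup H] [InnerProductSpace ℂ H] [CompleteSpace H] where
  toHom : G →* unitary (H →L[ℂ] H)
  strongly_continuous : ∀ φ : H, Continuous fun g => (toHom g : H →L[ℂ] H) φ

variable {G : Type*} [Group G] [TopologicalSpace G]
variable {H : Type*} [NormedAddCommGroup H] [InnerProductSpace ℂ H] [CompleteSpace H]

/-- The operator `U(g)`. -/
def UnitaryRep.op (U : UnitaryRep G H) (g : G) : H →L[ℂ] H := (U.toHom g : H →L[ℂ] H)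

/-- The action on observables: `g.A = U(g) A U(g)*`. -/
def UnitaryRep.actObs (U : UnitaryRep G H) (g : G) (A : H →L[ℂ] H) : H →L[ℂ] H :=
  U.op g ∘L A ∘L (U.op g).adjoint

/-- The action on trace class operators: `g.T = U(g)* T U(g)`. -/
def UnitaryRep.actState (U : UnitaryRep G H) (g : G) (T : H →L[ℂ] H) : H →L[ℂ] H :=
  (U.op g).adjoint ∘L T ∘L U.op g

end Representations

/-- A quantum reference frame on a homogeneous `G`-space `S`: a system of covariance `(U, E, H)`
based on `S`. -/
structure Frame (G : Type*) [Group G] [TopologicalSpace G]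
    (S : Type*) [TopologicalSpace S] [MeasurableSpace S] [MulAction G S]
    [ContinuousSMul G S] [MulAction.IsPretransitive G S]
    (H : Type*) [NormedAddCommGroup H] [InnerProductSpace ℂ H] [CompleteSpace H] where
  U : UnitaryRep G H
  E : POVM S H
  covariant : ∀ (g : G) (X : Set S), MeasurableSet X →
    E.toFun ((fun s => g • s) '' X) = U.actObs g (E.toFun X)

/-- `S` is a principal homogeneous `G`-space: for every base point `x` the orbit map `g ↦ g • x`
is a homeomorphism from `G` onto `S`. -/
def IsPrincipalSpace (G : Type*) [Group G] [TopologicalSpace G]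
    (S : Type*) [TopologicalSpace S] [MulAction G S] : Prop :=
  ∀ x : S, IsHomeomorph (fun g : G => g • x)

section FrameOnGroup

variable {G : Type*} [Group G] [TopologicalSpace G] [IsTopologicalGroup G]
  [MeasurableSpace G] [BorelSpace G]
variable {S : Type*} [TopologicalSpace S] [MeasurableSpace S] [BorelSpace S] [MulAction G S]
  [ContinuousSMul G S] [MulAction.IsPretransitive G S]
variable {H : Type*} [NormedAddCommGroup H] [InnerProductSpace ℂ H] [CompleteSpace H]

/-- The identification of a principal homogeneous space with `G` that sends the base point `x`
to the identity `e`, that is, the inverse of `g ↦ g • x`. -/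
def toGroup (hS : IsPrincipalSpace G S) (x : S) : S ≃ₜ G := ((hS x).homeomorph _).symm

theorem toGroup_smul (hS : IsPrincipalSpace G S) (x : S) (g : G) (s : S) :
    toGroup hS x (g • s) = g * toGroup hS x s := by
  apply (hS x).injective
  have key : ∀ t : S, (toGroup hS x t) • x = t := fun t =>
    ((hS x).homeomorph _).apply_symm_apply t
  simp only [key, mul_smul]

theorem toGroup_preimage_image (hS : IsPrincipalSpace G S) (x : S) (g : G) (Y : Set G) :
    (toGroup hS x) ⁻¹' ((fun k => g • k) '' Y) =
      (fun s => g • s) '' ((toGroup hS x) ⁻¹' Y) := by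
  ext s
  simp only [Set.mem_preimage, Set.mem_image, smul_eq_mul]
  constructor
  · rintro ⟨k, hk, hks⟩
    refine ⟨g⁻¹ • s, ?_, smul_inv_smul g s⟩
    rw [toGroup_smul, ← hks]
    simpa using hk
  · rintro ⟨t, ht, rfl⟩
    exact ⟨_, ht, (toGroup_smul hS x g t).symm⟩

/-- A frame on a principal homogeneous space, regarded as a frame on `G` by means of the
identification `g ↦ g • x`. -/
def Frame.onGroup (R : Frame G S H) (hS : IsPrincipalSpace G S) (x : S) : Frame G G H where
  U := R.U
  E := R.E.map (toGroup hS x) (toGroup hS x).measurable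
  covariant g Y hY := by
    change R.E.toFun ((toGroup hS x) ⁻¹' ((fun k => g • k) '' Y)) =
      R.U.actObs g (R.E.toFun ((toGroup hS x) ⁻¹' Y))
    rw [toGroup_preimage_image]
    exact R.covariant g _ ((toGroup hS x).measurable hY)

end FrameOnGroup

section Relativization

variable {G : Type*} [Group G] [TopologicalSpace G] [IsTopologicalGroup G]
  [MeasurableSpace G]
variable {H : Type*} [NormedAddCommGroup H] [InnerProductSpace ℂ H] [CompleteSpace H]
variable {K : Type*} [NormedAddCommGroup K] [InnerProductSpace ℂ K] [CompleteSpace K]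

/-- `T` is the weak operator integral `∫_G dE(g) ⊗ U(g) A U(g)*`: its expectation value in every
product vector `φ ⊗ ψ` is `∫_G ⟪ψ, U(g) A U(g)* ψ⟫ d⟪φ, E(g) φ⟫`. By polarization, and since the
product vectors span a dense subspace, at most one bounded operator `T` has this property. -/
def IsRelativization (E : POVM G H) (U : UnitaryRep G K) (A : K →L[ℂ] K)
    (T : HilbertTensor H K →L[ℂ] HilbertTensor H K) : Prop :=
  ∀ (φ : H) (ψ : K), ⟪tmul φ ψ, T (tmul φ ψ)⟫_ℂ =
    ∫ g, ⟪ψ, U.actObs g A ψ⟫_ℂ ∂(E.vectorMeasure φ)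

theorem tmul_add_left (φ φ' : H) (ψ : K) : tmul (φ + φ') ψ = tmul φ ψ + tmul φ' ψ := by
  simp only [tmul, TensorProduct.add_tmul]
  exact UniformSpace.Completion.coe_add _ _

theorem tmul_add_right (φ : H) (ψ ψ' : K) : tmul φ (ψ + ψ') = tmul φ ψ + tmul φ ψ' := by
  simp only [tmul, TensorProduct.tmul_add]
  exact UniformSpace.Completion.coe_add _ _

theorem tmul_smul_left (c : ℂ) (φ : H) (ψ : K) : tmul (c • φ) ψ = c • tmul φ ψ := by
  simp only [tmul, ← TensorProduct.smul_tmul']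
  exact UniformSpace.Completion.coe_smul _ _

theorem tmul_smul_right (c : ℂ) (φ : H) (ψ : K) : tmul φ (c • ψ) = c • tmul φ ψ := by
  simp only [tmul, TensorProduct.tmul_smul]
  exact UniformSpace.Completion.coe_smul _ _

theorem eq_zero_of_inner_tmul (D : HilbertTensor H K →L[ℂ] HilbertTensor H K)
    (hD : ∀ (φ : H) (ψ : K), ⟪tmul φ ψ, D (tmul φ ψ)⟫_ℂ = 0) : D = 0 := by
  have h1 : ∀ (φ φ' : H) (ψ : K), ⟪tmul φ ψ, D (tmul φ' ψ)⟫_ℂ = 0 := by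
    intro φ φ' ψ
    have a := hD (φ + φ') ψ
    have b := hD (φ + Complex.I • φ') ψ
    simp only [tmul_add_left, tmul_smul_left, map_add, map_smul, inner_add_left, inner_add_right,
      inner_smul_left, inner_smul_right, hD, Complex.conj_I] at a b
    have hI := Complex.I_mul_I
    linear_combination (1 / 2 : ℂ) * a - (Complex.I / 2) * b +
      (1 / 2 : ℂ) * (⟪tmul φ ψ, D (tmul φ' ψ)⟫_ℂ - ⟪tmul φ' ψ, D (tmul φ ψ)⟫_ℂ) * hI
  have h2 : ∀ (φ φ' : H) (ψ ψ' : K), ⟪tmul φ ψ, D (tmul φ' ψ')⟫_ℂ = 0 := by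
    intro φ φ' ψ ψ'
    have a := h1 φ φ' (ψ + ψ')
    have b := h1 φ φ' (ψ + Complex.I • ψ')
    simp only [tmul_add_right, tmul_smul_right, map_add, map_smul, inner_add_left,
      inner_add_right, inner_smul_left, inner_smul_right, h1, Complex.conj_I] at a b
    have hI := Complex.I_mul_I
    linear_combination (1 / 2 : ℂ) * a - (Complex.I / 2) * b +
      (1 / 2 : ℂ) * (⟪tmul φ ψ, D (tmul φ' ψ')⟫_ℂ - ⟪tmul φ ψ', D (tmul φ' ψ)⟫_ℂ) * hI
  have h3 : ∀ (φ : H) (ψ : K) (v : HilbertTensor H K), ⟪v, D (tmul φ ψ)⟫_ℂ = 0 := by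
    intro φ ψ v
    induction v using UniformSpace.Completion.induction_on with
    | hp => exact isClosed_eq (by fun_prop) continuous_const
    | ih t =>
      induction t using TensorProduct.induction_on with
      | zero => rw [UniformSpace.Completion.coe_zero, inner_zero_left]
      | tmul a b => exact h2 a φ b ψ
      | add x y hx hy =>
        rw [UniformSpace.Completion.coe_add, inner_add_left, hx, hy, add_zero]
  have h4 : ∀ (φ : H) (ψ : K), D (tmul φ ψ) = 0 := fun φ ψ => inner_self_eq_zero.mp (h3 φ ψ _)
  ext v
  induction v using UniformSpace.Completion.induction_on with
  | hp => exact isClosed_eq (by fun_prop) (by fun_prop)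
  | ih t =>
    induction t using TensorProduct.induction_on with
    | zero => rw [UniformSpace.Completion.coe_zero, map_zero, map_zero]
    | tmul a b => exact h4 a b
    | add x y hx hy => rw [UniformSpace.Completion.coe_add, map_add, map_add, hx, hy]

theorem IsRelativization.unique {E : POVM G H} {U : UnitaryRep G K} {A : K →L[ℂ] K}
    {T T' : HilbertTensor H K →L[ℂ] HilbertTensor H K}
    (hT : IsRelativization E U A T) (hT' : IsRelativization E U A T') : T = T' := by
  refine sub_eq_zero.mp (eq_zero_of_inner_tmul _ fun φ ψ => ?_)
  rw [sub_apply, inner_sub_right, hT φ ψ, hT' φ ψ, sub_self]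

open Classical in
/-- The relativization map of the frame `R`, `A ↦ ∫_G dE_R(g) ⊗ U(g) A U(g)*`. -/
def relativization (R : Frame G G H) (U : UnitaryRep G K) (A : K →L[ℂ] K) :
    HilbertTensor H K →L[ℂ] HilbertTensor H K :=
  if h : ∃ T, IsRelativization R.E U A T then h.choose else 0

/-- The observable `E₂ * E₁` of relative orientation of `R₂` with respect to `R₁`: the composition
of the relativization map of `R₁` with the frame observable of `R₂`. -/
def relativeOrientation (R₁ : Frame G G H) (R₂ : Frame G G K) (X : Set G) :
    HilbertTensor H K →L[ℂ] HilbertTensor H K :=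
  relativization R₁ R₂.U (R₂.E.toFun X)

end Relativization

end QRF

end

/-! The relative orientation observable distributes the outcome `g⁻¹ k` when `E₁` gives `g` and `E₂`
gives `k` independently: by covariance `⟪ψ, U₂(g) E₂(X) U₂(g)* ψ⟫` is the mass that the measure
of `ψ` gives to `g X`, and integrating it over `g` gives the mass of `{(g, k) | g⁻¹ k ∈ X}` for the
product measure. Writing states as mixtures of vector states extends this from product vectors to
product states, so that the Born measure of `ω ⊗ ρ` is the image of the product of the Born measures
of `ω` and `ρ` under the continuous map `(g, k) ↦ g⁻¹ k`. Translating `ρ` by `h` moves its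
localization point from `e` to `h`, and weak convergence passes to products and continuous images.

The operator integral exists for positive integrands as a limit, in the weak operator topology, of
uniformly bounded integrals of simple functions, and for all others because positive operators span.
-/

namespace QRF

section Tensor

variable {H : Type*} [NormedAddCommGroup H] [InnerProductSpace ℂ H]
variable {K : Type*} [NormedAddCommGroup K] [InnerProductSpace ℂ K]

theorem inner_tmul_tmul (φ φ' : H) (ψ ψ' : K) :
    ⟪tmul φ ψ, tmul φ' ψ'⟫_ℂ = ⟪φ, φ'⟫_ℂ * ⟪ψ, ψ'⟫_ℂ := by
  simp [tmul, UniformSpace.Completion.inner_coe]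

theorem norm_tmul (φ : H) (ψ : K) : ‖tmul φ ψ‖ = ‖φ‖ * ‖ψ‖ := by
  simp [tmul, UniformSpace.Completion.norm_coe]

theorem opTensor_tmul (A : H →L[ℂ] H) (B : K →L[ℂ] K) (φ : H) (ψ : K) :
    opTensor A B (tmul φ ψ) = tmul (A φ) (B ψ) := by
  simp [opTensor, tmul, ContinuousLinearMap.completion_apply_coe]

theorem inner_sqrt_sqrt [CompleteSpace H] {A : H →L[ℂ] H} (hA : A.IsPositive) (x y : H) :
    ⟪CFC.sqrt A x, CFC.sqrt A y⟫_ℂ = ⟪x, A y⟫_ℂ := by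
  have hsqrt : (CFC.sqrt A).IsPositive :=
    (ContinuousLinearMap.nonneg_iff_isPositive _).mp (CFC.sqrt_nonneg A)
  rw [hsqrt.inner_left_eq_inner_right, ← mul_apply_eq_comp,
    CFC.sqrt_mul_sqrt_self A ((ContinuousLinearMap.nonneg_iff_isPositive A).mpr hA)]

variable [CompleteSpace H] [CompleteSpace K]

theorem ext_inner_tmul {S T : HilbertTensor H K →L[ℂ] HilbertTensor H K}
    (h : ∀ (φ : H) (ψ : K), ⟪tmul φ ψ, S (tmul φ ψ)⟫_ℂ = ⟪tmul φ ψ, T (tmul φ ψ)⟫_ℂ) :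
    S = T := by
  refine sub_eq_zero.mp (eq_zero_of_inner_tmul _ fun φ ψ => ?_)
  rw [sub_apply, inner_sub_right, h, sub_self]

theorem isPositive_opTensor {A : H →L[ℂ] H} {B : K →L[ℂ] K} (hA : A.IsPositive)
    (hB : B.IsPositive) : (opTensor A B).IsPositive := by
  let R := opTensor (CFC.sqrt A) (CFC.sqrt B)
  have hR : opTensor A B = R.adjoint ∘L R := ext_inner_tmul fun φ ψ => by
    simp only [R, ContinuousLinearMap.comp_apply, ContinuousLinearMap.adjoint_inner_right,
      opTensor_tmul, inner_tmul_tmul, inner_sqrt_sqrt hA, inner_sqrt_sqrt hB]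
  exact hR ▸ ContinuousLinearMap.isPositive_adjoint_comp_self R

end Tensor

section Ensemble

open InnerProductSpace (rankOne)

variable {H : Type*} [NormedAddCommGroup H] [InnerProductSpace ℂ H]
variable {K : Type*} [NormedAddCommGroup K] [InnerProductSpace ℂ K]
variable {ι κ : Type*}

/-- `A` is the mixture `∑ᵢ |vᵢ⟩⟨vᵢ|` of the vectors `vᵢ`, which need not be orthogonal. Square
summability of the norms makes the series converge in trace norm, although only its convergence in
operator norm is recorded. -/
structure IsEnsemble (A : H →L[ℂ] H) (v : ι → H) : Prop where
  summable : Summable fun i => ‖v i‖ ^ 2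
  hasSum : HasSum (fun i => rankOne ℂ (v i) (v i)) A

theorem summable_sq_norm_apply {v : ι → H} (hv : Summable fun i => ‖v i‖ ^ 2) (T : H →L[ℂ] K) :
    Summable fun i => ‖T (v i)‖ ^ 2 := by
  refine .of_nonneg_of_le (fun _ => sq_nonneg _) (fun i => ?_) (hv.mul_left (‖T‖ ^ 2))
  rw [← mul_pow]
  gcongr
  exact T.le_opNorm (v i)

theorem IsEnsemble.hasSum_inner {A : H →L[ℂ] H} {v : ι → H} (hA : IsEnsemble A v) (x y : H) :
    HasSum (fun i => ⟪x, v i⟫_ℂ * ⟪v i, y⟫_ℂ) ⟪x, A y⟫_ℂ := by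
  simpa [inner_smul_right, mul_comm] using
    (hA.hasSum.mapL (ContinuousLinearMap.apply ℂ H y)).mapL (innerSL ℂ x)

theorem IsEnsemble.restrict_support {A : H →L[ℂ] H} {v : ι → H} (hA : IsEnsemble A v) :
    IsEnsemble A (fun i : Function.support v => v i) where
  summable := hA.summable.comp_injective Subtype.val_injective
  hasSum := by
    have hsub : (Function.support fun i => rankOne ℂ (v i) (v i)) ⊆ Function.support v :=
      fun i hi hvi => hi (by simp [hvi])
    exact (hasSum_subtype_iff_of_support_subset hsub).mpr hA.hasSum

theorem IsEnsemble.countable_support {A : H →L[ℂ] H} {v : ι → H} (hA : IsEnsemble A v) :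
    (Function.support v).Countable :=
  hA.summable.countable_support.mono fun i hi => by simpa using hi

theorem exists_isEnsemble [CompleteSpace H] {v : ι → H} (hv : Summable fun i => ‖v i‖ ^ 2) :
    ∃ A : H →L[ℂ] H, IsEnsemble A v := by
  have hsum : Summable fun i => rankOne ℂ (v i) (v i) := .of_norm (by simpa [← sq] using hv)
  exact ⟨_, hv, hsum.hasSum⟩

theorem isEnsemble_of_hasSum_inner [CompleteSpace H] {A : H →L[ℂ] H} {v : ι → H}
    (hv : Summable fun i => ‖v i‖ ^ 2)
    (h : ∀ x y, HasSum (fun i => ⟪x, v i⟫_ℂ * ⟪v i, y⟫_ℂ) ⟪x, A y⟫_ℂ) : IsEnsemble A v := by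
  obtain ⟨B, hB⟩ := exists_isEnsemble hv
  have hAB : A = B := ContinuousLinearMap.ext fun y => ext_inner_left ℂ fun x =>
    (h x y).unique (hB.hasSum_inner x y)
  rwa [hAB]

theorem hasSum_sq_norm_inner (b : HilbertBasis κ ℂ H) (x : H) :
    HasSum (fun j => ‖⟪b j, x⟫_ℂ‖ ^ 2) (‖x‖ ^ 2) := by
  have h := Complex.hasSum_re (b.hasSum_inner_mul_inner x x)
  rw [inner_self_eq_norm_sq_to_K] at h
  convert h using 2 with j
  · rw [← inner_conj_symm x, ← Complex.normSq_eq_conj_mul_self, Complex.normSq_eq_norm_sq,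
      Complex.ofReal_re]
  · norm_cast

theorem summable_inner_mul_inner_prod (b : HilbertBasis κ ℂ H) {u v : ι → H}
    (hu : Summable fun i => ‖u i‖ ^ 2) (hv : Summable fun i => ‖v i‖ ^ 2) :
    Summable fun p : ι × κ => ⟪u p.1, b p.2⟫_ℂ * ⟪b p.2, v p.1⟫_ℂ := by
  have hsq : ∀ {w : ι → H}, Summable (fun i => ‖w i‖ ^ 2) →
      Summable fun p : ι × κ => ‖⟪b p.2, w p.1⟫_ℂ‖ ^ 2 := fun {w} hw => by
    refine (summable_prod_of_nonneg fun _ => sq_nonneg _).mpr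
      ⟨fun i => (hasSum_sq_norm_inner b (w i)).summable, ?_⟩
    simpa only [(hasSum_sq_norm_inner b (w _)).tsum_eq] using hw
  refine .of_norm_bounded ((hsq hu).add (hsq hv)) fun p => ?_
  rw [norm_mul, norm_inner_symm]
  nlinarith [sq_nonneg (‖⟪b p.2, u p.1⟫_ℂ‖ - ‖⟪b p.2, v p.1⟫_ℂ‖),
    sq_nonneg ‖⟪b p.2, u p.1⟫_ℂ‖, sq_nonneg ‖⟪b p.2, v p.1⟫_ℂ‖]

variable [CompleteSpace H] [CompleteSpace K]

theorem IsEnsemble.conj_adjoint {A : H →L[ℂ] H} {v : ι → H} (hA : IsEnsemble A v)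
    (V : H →L[ℂ] K) : IsEnsemble (V ∘L A ∘L V.adjoint) (fun i => V (v i)) := by
  refine isEnsemble_of_hasSum_inner (summable_sq_norm_apply hA.summable V) fun x y => ?_
  simpa only [ContinuousLinearMap.adjoint_inner_left, ContinuousLinearMap.adjoint_inner_right,
    ContinuousLinearMap.comp_apply] using hA.hasSum_inner (V.adjoint x) (V.adjoint y)

theorem isEnsemble_opTensor {A : H →L[ℂ] H} {B : K →L[ℂ] K} {v : ι → H} {w : κ → K}
    (hA : IsEnsemble A v) (hB : IsEnsemble B w) :
    IsEnsemble (opTensor A B) (fun p : ι × κ => tmul (v p.1) (w p.2)) := by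
  have hsq : Summable fun p : ι × κ => ‖tmul (v p.1) (w p.2)‖ ^ 2 := by
    simp only [norm_tmul, mul_pow]
    exact hA.summable.mul_of_nonneg hB.summable (fun _ => sq_nonneg _) (fun _ => sq_nonneg _)
  obtain ⟨D, hD⟩ := exists_isEnsemble hsq
  suffices opTensor A B = D by rwa [this]
  refine ext_inner_tmul fun φ ψ => ?_
  have hφ := hA.hasSum_inner φ φ
  have hψ := hB.hasSum_inner ψ ψ
  have hφψ := hφ.mul hψ <| summable_mul_of_summable_norm (f := fun i => ⟪φ, v i⟫_ℂ * ⟪v i, φ⟫_ℂ)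
    (g := fun j => ⟪ψ, w j⟫_ℂ * ⟪w j, ψ⟫_ℂ) hφ.summable.norm hψ.summable.norm
  rw [opTensor_tmul, inner_tmul_tmul]
  refine hφψ.unique ((hD.hasSum_inner (tmul φ ψ) (tmul φ ψ)).congr_fun fun p => ?_)
  simp only [inner_tmul_tmul]
  ring

theorem IsEnsemble.hasSum_trace_comp {A : H →L[ℂ] H} {v : ι → H} (hA : IsEnsemble A v)
    (T : H →L[ℂ] H) : HasSum (fun i => ⟪v i, T (v i)⟫_ℂ) (trace (A ∘L T)) := by
  let b := basis H
  let F : ι × basisIndex H → ℂ := fun p => ⟪T.adjoint (v p.1), b p.2⟫_ℂ * ⟪b p.2, v p.1⟫_ℂ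
  have hF : Summable F :=
    summable_inner_mul_inner_prod b (u := fun i => T.adjoint (v i))
      (summable_sq_norm_apply hA.summable T.adjoint) hA.summable
  have hrow : ∀ i, HasSum (fun j => F (i, j)) ⟪v i, T (v i)⟫_ℂ := fun i => by
    have h := b.hasSum_inner_mul_inner (T.adjoint (v i)) (v i)
    rwa [ContinuousLinearMap.adjoint_inner_left] at h
  have hcol : ∀ j, HasSum (fun i => F (i, j)) ⟪b j, (A ∘L T) (b j)⟫_ℂ := fun j =>
    (hA.hasSum_inner (b j) (T (b j))).congr_fun fun i => by
      simp only [F, ContinuousLinearMap.adjoint_inner_left]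
      ring
  have htrace : HasSum (fun j => ⟪b j, (A ∘L T) (b j)⟫_ℂ) (∑' p, F p) :=
    ((Equiv.prodComm _ _).hasSum_iff.mpr hF.hasSum).prod_fiberwise hcol
  rw [trace, htrace.tsum_eq]
  exact hF.hasSum.prod_fiberwise hrow

theorem State.exists_isEnsemble (ω : State H) :
    ∃ v : basisIndex H → H, IsEnsemble ω.op v := by
  let b := basis H
  have hsummable : Summable fun i => ⟪b i, ω.op (b i)⟫_ℂ := by
    by_contra hdiv
    have htrace := ω.trace_eq_one
    rw [trace, tsum_eq_zero_of_not_summable hdiv] at htrace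
    exact zero_ne_one htrace
  refine ⟨fun i => CFC.sqrt ω.op (b i), isEnsemble_of_hasSum_inner ?_ fun x y => ?_⟩
  · refine (Complex.hasSum_re hsummable.hasSum).summable.congr fun i => ?_
    rw [← inner_sqrt_sqrt ω.isPositive, inner_self_eq_norm_sq_to_K]
    norm_cast
  · have hsqrt : (CFC.sqrt ω.op).IsPositive :=
      (ContinuousLinearMap.nonneg_iff_isPositive _).mp (CFC.sqrt_nonneg ω.op)
    simpa only [inner_sqrt_sqrt ω.isPositive, hsqrt.inner_left_eq_inner_right _ (b _),
      ← hsqrt.inner_left_eq_inner_right (b _)] using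
      b.hasSum_inner_mul_inner (CFC.sqrt ω.op x) (CFC.sqrt ω.op y)

theorem State.exists_countable_isEnsemble (ω : State H) :
    ∃ s : Set (basisIndex H), s.Countable ∧ ∃ v : s → H, IsEnsemble ω.op v := by
  obtain ⟨v, hv⟩ := ω.exists_isEnsemble
  exact ⟨_, hv.countable_support, _, hv.restrict_support⟩

end Ensemble

section WeakCompactness

variable {H : Type*} [NormedAddCommGroup H] [InnerProductSpace ℂ H]
variable {K : Type*} [NormedAddCommGroup K] [InnerProductSpace ℂ K] [CompleteSpace K]
variable {ι : Type*}

theorem exists_tendsto_inner_of_norm_le (l : Ultrafilter ι) {u : ι → K} {C : ℝ}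
    (hu : ∀ i, ‖u i‖ ≤ C) :
    ∃ y : K, ‖y‖ ≤ C ∧ ∀ x, Tendsto (fun i => ⟪x, u i⟫_ℂ) l (𝓝 ⟪x, y⟫_ℂ) := by
  let f : ι → WeakDual ℂ K := fun i => (InnerProductSpace.toDual ℂ K (u i)).toWeakDual
  obtain ⟨z, hz, hlim⟩ := (WeakDual.isCompact_closedBall (0 : StrongDual ℂ K) C).ultrafilter_le_nhds
    (l.map f) (le_principal_iff.mpr
      (Filter.mem_map.mpr (Eventually.of_forall fun i => by simpa [f] using hu i)))
  refine ⟨(InnerProductSpace.toDual ℂ K).symm (WeakDual.toStrongDual z), by simpa using hz,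
    fun x => ?_⟩
  have hx : Tendsto (fun i => ⟪u i, x⟫_ℂ) l (𝓝 (z x)) :=
    ((WeakDual.eval_continuous x).tendsto z).comp hlim
  rw [← inner_conj_symm, InnerProductSpace.toDual_symm_apply]
  exact ((Complex.continuous_conj.tendsto _).comp hx).congr fun i => inner_conj_symm x (u i)

theorem exists_tendsto_inner_apply_of_norm_le (l : Ultrafilter ι) {T : ι → H →L[ℂ] K} {C : ℝ}
    (hT : ∀ i, ‖T i‖ ≤ C) :
    ∃ S : H →L[ℂ] K, ∀ x y, Tendsto (fun i => ⟪x, T i y⟫_ℂ) l (𝓝 ⟪x, S y⟫_ℂ) := by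
  choose S hSC hS using fun y : H =>
    exists_tendsto_inner_of_norm_le l fun i => (T i).le_of_opNorm_le (hT i) y
  let L : H →ₗ[ℂ] K :=
    { toFun := S
      map_add' := fun y y' => ext_inner_left ℂ fun x => tendsto_nhds_unique (hS (y + y') x) <| by
        simpa only [map_add, inner_add_right] using (hS y x).add (hS y' x)
      map_smul' := fun c y => ext_inner_left ℂ fun x => tendsto_nhds_unique (hS (c • y) x) <| by
        simpa only [map_smul, inner_smul_right, RingHom.id_apply] using (hS y x).const_mul c }
  exact ⟨L.mkContinuous C hSC, fun x y => hS y x⟩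

end WeakCompactness

section OperatorIntegral

variable {S : Type*} [MeasurableSpace S]
variable {H : Type*} [NormedAddCommGroup H] [InnerProductSpace ℂ H]
variable {K : Type*} [NormedAddCommGroup K] [InnerProductSpace ℂ K]

theorem POVM.inner_toFun_self (E : POVM S H) {X : Set S} (hX : MeasurableSet X) (φ : H) :
    ⟪φ, E.toFun X φ⟫_ℂ = ((E.vectorMeasure φ).real X : ℂ) := by
  rw [Measure.real, E.vectorMeasure_apply φ hX, ENNReal.toReal_ofReal (E.re_nonneg hX φ)]
  exact Complex.eq_re_of_ofReal_le ((E.isPositive X hX).inner_nonneg_right φ)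

instance (E : POVM S H) (φ : H) : IsFiniteMeasure (E.vectorMeasure φ) :=
  ⟨by rw [E.vectorMeasure_apply φ MeasurableSet.univ]; exact ENNReal.ofReal_lt_top⟩

theorem POVM.vectorMeasure_real_univ (E : POVM S H) (φ : H) :
    ((E.vectorMeasure φ).real Set.univ : ℂ) = ⟪φ, φ⟫_ℂ := by
  rw [← E.inner_toFun_self MeasurableSet.univ, E.map_univ, one_apply_eq_self]

theorem integral_comp_simpleFunc {α E : Type*} [NormedAddCommGroup E] [NormedSpace ℝ E]
    [CompleteSpace E] (μ : Measure S) [IsFiniteMeasure μ] (s : SimpleFunc S α) (f : α → E) :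
    ∫ x, f (s x) ∂μ = ∑ y ∈ s.range, μ.real (s ⁻¹' {y}) • f y := by
  have hindicator : ∀ x, f (s x) = ∑ y ∈ s.range, (s ⁻¹' {y}).indicator (fun _ => f y) x :=
    fun x => by
      rw [Finset.sum_eq_single_of_mem (s x) (s.mem_range_self x) fun y _ hy =>
        Set.indicator_of_notMem (fun hx => hy hx.symm) _]
      simp
  simp_rw [hindicator]
  rw [integral_finsetSum _ fun y _ => (integrable_const _).indicator (s.measurableSet_fiber y)]
  exact Finset.sum_congr rfl fun y _ => integral_indicator_const _ (s.measurableSet_fiber y)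

/-- The operator integral `∫ dE(x) ⊗ F(s(x))` of a function of a simple function `s`. Letting `F`
be any function on the values of `s`, rather than integrating operator valued simple functions,
allows one sequence `s` to serve for all approximations. -/
noncomputable def simpleIntegral {α : Type*} (E : POVM S H) (s : SimpleFunc S α)
    (F : α → K →L[ℂ] K) : HilbertTensor H K →L[ℂ] HilbertTensor H K :=
  ∑ y ∈ s.range, opTensor (E.toFun (s ⁻¹' {y})) (F y)

variable {α : Type*} (E : POVM S H) (s : SimpleFunc S α)

theorem inner_simpleIntegral (F : α → K →L[ℂ] K) (φ : H) (ψ : K) :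
    ⟪tmul φ ψ, simpleIntegral E s F (tmul φ ψ)⟫_ℂ =
      ∫ x, ⟪ψ, F (s x) ψ⟫_ℂ ∂(E.vectorMeasure φ) := by
  rw [integral_comp_simpleFunc _ s fun y => ⟪ψ, F y ψ⟫_ℂ, simpleIntegral, sum_apply, inner_sum]
  refine Finset.sum_congr rfl fun y _ => ?_
  rw [opTensor_tmul, inner_tmul_tmul, E.inner_toFun_self (s.measurableSet_fiber y),
    Complex.real_smul]

variable [CompleteSpace H] [CompleteSpace K]

theorem isPositive_simpleIntegral {F : α → K →L[ℂ] K} (hF : ∀ y, (F y).IsPositive) :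
    (simpleIntegral E s F).IsPositive :=
  ContinuousLinearMap.isPositive_sum _ fun y _ =>
    isPositive_opTensor (E.isPositive _ (s.measurableSet_fiber y)) (hF y)

theorem simpleIntegral_const_sub (F : α → K →L[ℂ] K) (c : ℂ) :
    simpleIntegral E s (fun y => c • 1 - F y) = c • 1 - simpleIntegral E s F := by
  refine ext_inner_tmul fun φ ψ => ?_
  have hint : Integrable (fun x => ⟪ψ, F (s x) ψ⟫_ℂ) (E.vectorMeasure φ) :=
    (s.map fun y => ⟪ψ, F y ψ⟫_ℂ).integrable_of_isFiniteMeasure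
  rw [sub_apply, inner_sub_right, inner_simpleIntegral, inner_simpleIntegral]
  simp only [sub_apply, smul_apply, one_apply_eq_self, inner_sub_right, inner_smul_right]
  rw [integral_sub (integrable_const _) hint, integral_const, inner_tmul_tmul,
    Complex.real_smul, E.vectorMeasure_real_univ]
  ring

theorem norm_simpleIntegral_le {F : α → K →L[ℂ] K} (hF : ∀ y, (F y).IsPositive) {C : ℝ}
    (hC : 0 ≤ C) (hFC : ∀ y, ‖F y‖ ≤ C) : ‖simpleIntegral E s F‖ ≤ C := by
  rw [CStarAlgebra.norm_le_iff_le_algebraMap _ hC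
    ((ContinuousLinearMap.nonneg_iff_isPositive _).mpr (isPositive_simpleIntegral E s hF)),
    ContinuousLinearMap.le_def]
  have hle : ∀ y, ((C : ℂ) • 1 - F y).IsPositive := fun y => by
    have h := (CStarAlgebra.norm_le_iff_le_algebraMap _ hC
      ((ContinuousLinearMap.nonneg_iff_isPositive _).mpr (hF y))).mp (hFC y)
    rwa [ContinuousLinearMap.le_def, Algebra.algebraMap_eq_smul_one] at h
  have h := isPositive_simpleIntegral E s hle
  rwa [simpleIntegral_const_sub] at h

theorem exists_inner_tmul_eq_integral {S : Type*} [TopologicalSpace S]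
    [TopologicalSpace.PseudoMetrizableSpace S] [SecondCountableTopology S] [MeasurableSpace S]
    [OpensMeasurableSpace S] (E : POVM S H) {F : S → K →L[ℂ] K} (hF : ∀ x, (F x).IsPositive)
    {C : ℝ} (hFC : ∀ x, ‖F x‖ ≤ C) (hcont : ∀ ψ, Continuous fun x => ⟪ψ, F x ψ⟫_ℂ) :
    ∃ T : HilbertTensor H K →L[ℂ] HilbertTensor H K, ∀ φ ψ,
      ⟪tmul φ ψ, T (tmul φ ψ)⟫_ℂ = ∫ x, ⟪ψ, F x ψ⟫_ℂ ∂(E.vectorMeasure φ) := by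
  rcases isEmpty_or_nonempty S with hS | ⟨⟨x₀⟩⟩
  · exact ⟨0, fun φ ψ => by simp [Measure.eq_zero_of_isEmpty]⟩
  have hC : 0 ≤ C := (norm_nonneg _).trans (hFC x₀)
  let s : ℕ → SimpleFunc S S := (stronglyMeasurable_id (α := S)).approx
  have hs : ∀ x, Tendsto (fun n => s n x) atTop (𝓝 x) := stronglyMeasurable_id.tendsto_approx
  obtain ⟨T, hT⟩ := exists_tendsto_inner_apply_of_norm_le (Ultrafilter.of atTop) fun n =>
    norm_simpleIntegral_le E (s n) hF hC hFC
  refine ⟨T, fun φ ψ => tendsto_nhds_unique (hT _ _) ?_⟩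
  simp only [inner_simpleIntegral]
  refine Tendsto.mono_left ?_ (Ultrafilter.of_le _)
  refine tendsto_integral_of_dominated_convergence (fun _ => ‖ψ‖ * (C * ‖ψ‖))
    (fun n => ((s n).map fun x => ⟪ψ, F x ψ⟫_ℂ).aestronglyMeasurable) (integrable_const _)
    (fun n => Eventually.of_forall fun x => ?_)
    (Eventually.of_forall fun x => ((hcont ψ).tendsto x).comp (hs x))
  refine (norm_inner_le_norm _ _).trans ?_
  gcongr
  exact (F (s n x)).le_of_opNorm_le (hFC _) ψ

end OperatorIntegral

section UnitaryRep

variable {G : Type*} [Group G] [TopologicalSpace G]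
variable {K : Type*} [NormedAddCommGroup K] [InnerProductSpace ℂ K] [CompleteSpace K]

namespace UnitaryRep

theorem adjoint_op (U : UnitaryRep G K) (g : G) : (U.op g).adjoint = U.op g⁻¹ := by
  rw [op, op, map_inv, ← ContinuousLinearMap.star_eq_adjoint]
  rfl

theorem inner_op_op (U : UnitaryRep G K) (g : G) (x y : K) :
    ⟪U.op g x, U.op g y⟫_ℂ = ⟪x, y⟫_ℂ :=
  ContinuousLinearMap.inner_map_map_of_mem_unitary (U.toHom g).2 x y

theorem inner_actObs (U : UnitaryRep G K) (g : G) (A : K →L[ℂ] K) (x y : K) :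
    ⟪x, U.actObs g A y⟫_ℂ = ⟪U.op g⁻¹ x, A (U.op g⁻¹ y)⟫_ℂ := by
  simp only [actObs, ContinuousLinearMap.comp_apply, ← U.adjoint_op,
    ContinuousLinearMap.adjoint_inner_left]

theorem norm_actObs (U : UnitaryRep G K) (g : G) (A : K →L[ℂ] K) : ‖U.actObs g A‖ = ‖A‖ := by
  rw [actObs, U.adjoint_op]
  exact (CStarRing.norm_coe_unitary_mul (U.toHom g) _).trans
    (CStarRing.norm_mul_coe_unitary A (U.toHom g⁻¹))

theorem isPositive_actObs (U : UnitaryRep G K) (g : G) {A : K →L[ℂ] K} (hA : A.IsPositive) :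
    (U.actObs g A).IsPositive :=
  hA.conj_adjoint (U.op g)

theorem norm_inner_actObs_le (U : UnitaryRep G K) (g : G) (A : K →L[ℂ] K) (x y : K) :
    ‖⟪x, U.actObs g A y⟫_ℂ‖ ≤ ‖x‖ * (‖A‖ * ‖y‖) := by
  refine (norm_inner_le_norm _ _).trans ?_
  gcongr
  exact (U.actObs g A).le_of_opNorm_le (U.norm_actObs g A).le y

theorem continuous_inner_actObs [IsTopologicalGroup G] (U : UnitaryRep G K) (A : K →L[ℂ] K)
    (x y : K) : Continuous fun g => ⟪x, U.actObs g A y⟫_ℂ := by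
  simp only [inner_actObs]
  have hop : ∀ z, Continuous fun g : G => U.op g⁻¹ z := fun z =>
    (U.strongly_continuous z).comp continuous_inv
  exact (hop x).inner (A.continuous.comp (hop y))

end UnitaryRep

theorem IsEnsemble.actState {ι : Type*} {A : K →L[ℂ] K} {v : ι → K} (hA : IsEnsemble A v)
    (U : UnitaryRep G K) (g : G) : IsEnsemble (U.actState g A) (fun i => U.op g⁻¹ (v i)) := by
  simpa only [UnitaryRep.actState, U.adjoint_op, inv_inv] using hA.conj_adjoint (U.op g⁻¹)

theorem IsEnsemble.trace_actState {ι : Type*} {A : K →L[ℂ] K} {v : ι → K} (hA : IsEnsemble A v)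
    (U : UnitaryRep G K) (g : G) : trace (U.actState g A) = trace A := by
  have htrace := hA.hasSum_trace_comp 1
  have htrace_act := (hA.actState U g).hasSum_trace_comp 1
  simp only [one_apply_eq_self, U.inner_op_op] at htrace htrace_act
  exact htrace_act.unique htrace

/-- The translate `g.ρ = U(g)* ρ U(g)` of a state. -/
noncomputable def State.act (U : UnitaryRep G K) (g : G) (ρ : State K) : State K where
  op := U.actState g ρ.op
  isPositive := ρ.isPositive.adjoint_conj (U.op g)
  trace_eq_one := by
    obtain ⟨v, hv⟩ := ρ.exists_isEnsemble
    rw [hv.trace_actState, ρ.trace_eq_one]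

end UnitaryRep

section Relativization

variable {G : Type*} [Group G] [TopologicalSpace G] [MeasurableSpace G]
variable {H : Type*} [NormedAddCommGroup H] [InnerProductSpace ℂ H]
variable {K : Type*} [NormedAddCommGroup K] [InnerProductSpace ℂ K] [CompleteSpace K]

theorem IsRelativization.smul {E : POVM G H} {U : UnitaryRep G K} {A : K →L[ℂ] K}
    {T : HilbertTensor H K →L[ℂ] HilbertTensor H K} (hT : IsRelativization E U A T) (c : ℂ) :
    IsRelativization E U (c • A) (c • T) := fun φ ψ => by
  simp only [UnitaryRep.inner_actObs, smul_apply, inner_smul_right, hT φ ψ, integral_const_mul]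

variable [IsTopologicalGroup G] [OpensMeasurableSpace G]

theorem integrable_inner_actObs (U : UnitaryRep G K) (A : K →L[ℂ] K)
    (ψ : K) (μ : Measure G) [IsFiniteMeasure μ] :
    Integrable (fun g => ⟪ψ, U.actObs g A ψ⟫_ℂ) μ :=
  .of_bound (U.continuous_inner_actObs A ψ ψ).measurable.aestronglyMeasurable _
    (Eventually.of_forall fun g => U.norm_inner_actObs_le g A ψ ψ)

theorem IsRelativization.add {E : POVM G H} {U : UnitaryRep G K}
    {A B : K →L[ℂ] K} {T T' : HilbertTensor H K →L[ℂ] HilbertTensor H K}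
    (hT : IsRelativization E U A T) (hT' : IsRelativization E U B T') :
    IsRelativization E U (A + B) (T + T') := fun φ ψ => by
  have hadd := integral_add (integrable_inner_actObs U A ψ (E.vectorMeasure φ))
    (integrable_inner_actObs U B ψ (E.vectorMeasure φ))
  simp only [UnitaryRep.inner_actObs, add_apply, inner_add_right, hT φ ψ, hT' φ ψ] at hadd ⊢
  exact hadd.symm

variable [CompleteSpace H] [SecondCountableTopology G]

theorem exists_isRelativization (E : POVM G H) (U : UnitaryRep G K) (A : K →L[ℂ] K) :
    ∃ T, IsRelativization E U A T := by
  have hA : A ∈ Submodule.span ℂ {B : K →L[ℂ] K | 0 ≤ B} :=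
    CStarAlgebra.span_nonneg (A := K →L[ℂ] K) ▸ Submodule.mem_top
  induction hA using Submodule.span_induction with
  | mem B hB =>
    exact exists_inner_tmul_eq_integral E
      (fun g => U.isPositive_actObs g ((ContinuousLinearMap.nonneg_iff_isPositive B).mp hB))
      (fun g => (U.norm_actObs g B).le) fun ψ => U.continuous_inner_actObs B ψ ψ
  | zero => exact ⟨0, fun φ ψ => by simp [UnitaryRep.actObs]⟩
  | add B C _ _ hB hC =>
    obtain ⟨T, hT⟩ := hB
    obtain ⟨T', hT'⟩ := hC
    exact ⟨T + T', hT.add hT'⟩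
  | smul c B _ hB =>
    obtain ⟨T, hT⟩ := hB
    exact ⟨c • T, hT.smul c⟩

theorem isRelativization_relativization (R : Frame G G H) (U : UnitaryRep G K)
    (A : K →L[ℂ] K) : IsRelativization R.E U A (relativization R U A) := by
  have hexists := exists_isRelativization R.E U A
  rw [relativization, dif_pos hexists]
  exact hexists.choose_spec

end Relativization

section Born

variable {S : Type*} [MeasurableSpace S] {S' : Type*} [MeasurableSpace S']
variable {H : Type*} [NormedAddCommGroup H] [InnerProductSpace ℂ H] [CompleteSpace H]

theorem IsEnsemble.isBornMeasure_iff_eq_sum {ι : Type*} {A : H →L[ℂ] H} {v : ι → H}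
    (hA : IsEnsemble A v) {T : Set S → H →L[ℂ] H} {m : ι → Measure S} [∀ i, IsFiniteMeasure (m i)]
    (hm : ∀ i X, MeasurableSet X → ⟪v i, T X (v i)⟫_ℂ = ((m i).real X : ℂ))
    {μ : ProbabilityMeasure S} :
    IsBornMeasure T A μ ↔ (μ : Measure S) = Measure.sum m := by
  have htrace : ∀ X, MeasurableSet X →
      HasSum (fun i => ((m i).real X : ℂ)) (trace (A ∘L T X)) := fun X hX => by
    simpa only [hm _ X hX] using hA.hasSum_trace_comp (T X)
  refine ⟨fun hμ => Measure.ext fun X hX => ?_, fun hμ X hX => ?_⟩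
  · have hsum := htrace X hX
    rw [← hμ X hX, Complex.hasSum_ofReal] at hsum
    rw [Measure.sum_apply _ hX, ← ENNReal.ofReal_toReal (measure_ne_top (μ : Measure S) X),
      ← hsum.tsum_eq, ENNReal.ofReal_tsum_of_nonneg (fun _ => measureReal_nonneg) hsum.summable]
    exact tsum_congr fun i => ofReal_measureReal
  · have hfinite := measure_ne_top (μ : Measure S) X
    rw [hμ, Measure.sum_apply _ hX] at hfinite ⊢
    rw [ENNReal.tsum_toReal_eq (ENNReal.ne_top_of_tsum_ne_top hfinite)]
    exact (Complex.hasSum_ofReal.mpr (ENNReal.hasSum_toReal hfinite)).unique (htrace X hX)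

theorem IsBornMeasure.map {E : POVM S H} {A : H →L[ℂ] H} {μ : ProbabilityMeasure S}
    (hμ : IsBornMeasure E.toFun A μ) {f : S → S'} (hf : Measurable f) :
    IsBornMeasure (E.map f hf).toFun A (μ.map hf.aemeasurable) := fun X hX => by
  rw [ProbabilityMeasure.toMeasure_map, Measure.map_apply hf hX]
  exact hμ _ (hf hX)

theorem map_diracProba {f : S → S'} (hf : Measurable f) (x : S) :
    (diracProba x).map hf.aemeasurable = diracProba (f x) :=
  Subtype.ext (Measure.map_dirac' hf x)

theorem prod_diracProba (x : S) (y : S') :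
    (diracProba x).prod (diracProba y) = diracProba (x, y) :=
  Subtype.ext Measure.dirac_prod_dirac

theorem IsLocalizingSequence.map [TopologicalSpace S] [OpensMeasurableSpace S]
    [TopologicalSpace S'] [BorelSpace S'] {E : POVM S H} {x : S} {ω : ℕ → State H}
    (hω : IsLocalizingSequence E x ω) {f : S → S'} (hf : Continuous f) :
    IsLocalizingSequence (E.map f hf.measurable) (f x) ω := by
  obtain ⟨μ, hμ, hlim⟩ := hω
  refine ⟨_, fun n => (hμ n).map hf.measurable, ?_⟩
  rw [← map_diracProba hf.measurable]
  exact ProbabilityMeasure.tendsto_map_of_tendsto_of_continuous _ _ hlim hf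

end Born

section Covariance

variable {G : Type*} [Group G] [TopologicalSpace G]
variable {S : Type*} [TopologicalSpace S] [MulAction G S]

theorem toGroup_self (hS : IsPrincipalSpace G S) (x : S) : toGroup hS x x = 1 := by
  rw [toGroup, Homeomorph.symm_apply_eq]
  exact (one_smul G x).symm

variable [MeasurableSpace S] [BorelSpace S] [ContinuousSMul G S] [MulAction.IsPretransitive G S]
variable {H : Type*} [NormedAddCommGroup H] [InnerProductSpace ℂ H] [CompleteSpace H]

theorem Frame.vectorMeasure_op (R : Frame G S H) (g : G) (φ : H) :
    R.E.vectorMeasure (R.U.op g φ) = (R.E.vectorMeasure φ).map (fun s => g • s) := by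
  have hsmul : Measurable fun s : S => g • s := (continuous_const_smul g).measurable
  ext X hX
  have hpreimage : (fun s => g • s) ⁻¹' X = (fun s => g⁻¹ • s) '' X := by
    rw [Set.preimage_smul, Set.image_smul]
  have hinner := R.U.inner_actObs g⁻¹ (R.E.toFun X) φ φ
  rw [inv_inv] at hinner
  rw [Measure.map_apply hsmul hX, R.E.vectorMeasure_apply _ hX,
    R.E.vectorMeasure_apply _ (hsmul hX), hpreimage, R.covariant _ X hX, hinner]

theorem IsBornMeasure.act {R : Frame G S H} {ρ : State H} {μ : ProbabilityMeasure S}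
    (hμ : IsBornMeasure R.E.toFun ρ.op μ) (g : G) :
    IsBornMeasure R.E.toFun (ρ.act R.U g).op
      (μ.map (continuous_const_smul g⁻¹).measurable.aemeasurable) := by
  obtain ⟨v, hv⟩ := ρ.exists_isEnsemble
  have hμ' := (hv.isBornMeasure_iff_eq_sum fun i X hX => R.E.inner_toFun_self hX (v i)).mp hμ
  refine ((hv.actState R.U g).isBornMeasure_iff_eq_sum
    fun i X hX => R.E.inner_toFun_self hX _).mpr ?_
  simp only [ProbabilityMeasure.toMeasure_map, R.vectorMeasure_op, hμ']
  exact Measure.map_sum (continuous_const_smul g⁻¹).measurable.aemeasurable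

theorem IsLocalizingSequence.act {R : Frame G S H} {x : S} {ρ : ℕ → State H}
    (hρ : IsLocalizingSequence R.E x ρ) (g : G) :
    IsLocalizingSequence R.E (g⁻¹ • x) (fun n => (ρ n).act R.U g) := by
  obtain ⟨μ, hμ, hlim⟩ := hρ
  have hsmul : Continuous fun s : S => g⁻¹ • s := continuous_const_smul g⁻¹
  refine ⟨_, fun n => (hμ n).act g, ?_⟩
  rw [← map_diracProba hsmul.measurable]
  exact ProbabilityMeasure.tendsto_map_of_tendsto_of_continuous _ _ hlim hsmul

end Covariance

section Orientation

variable {G : Type*} [Group G] [TopologicalSpace G] [IsTopologicalGroup G]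
  [MeasurableSpace G] [BorelSpace G]

theorem IsLocalizingSequence.onGroup {S : Type*} [TopologicalSpace S] [MeasurableSpace S]
    [BorelSpace S] [MulAction G S] [ContinuousSMul G S] [MulAction.IsPretransitive G S]
    {H : Type*} [NormedAddCommGroup H] [InnerProductSpace ℂ H] [CompleteSpace H]
    {R : Frame G S H} {x : S} {ω : ℕ → State H} (hω : IsLocalizingSequence R.E x ω)
    (hS : IsPrincipalSpace G S) : IsLocalizingSequence (R.onGroup hS x).E 1 ω :=
  toGroup_self hS x ▸ hω.map (toGroup hS x).continuous

variable [SecondCountableTopology G]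

/-- The distribution of the relative orientation `g⁻¹ k` of independent orientations `g` and `k`
with distributions `μ` and `ν`. -/
noncomputable def relativeLaw (μ ν : ProbabilityMeasure G) : ProbabilityMeasure G :=
  (μ.prod ν).map (f := fun p => p.1⁻¹ * p.2) (by fun_prop)

theorem continuous_relativeLaw :
    Continuous fun p : ProbabilityMeasure G × ProbabilityMeasure G => relativeLaw p.1 p.2 :=
  (ProbabilityMeasure.continuous_map (by fun_prop)).comp ProbabilityMeasure.continuous_prod

theorem relativeLaw_diracProba (g k : G) :
    relativeLaw (diracProba g) (diracProba k) = diracProba (g⁻¹ * k) := by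
  simp only [relativeLaw, prod_diracProba]
  exact map_diracProba (by fun_prop) _

variable {H : Type*} [NormedAddCommGroup H] [InnerProductSpace ℂ H] [CompleteSpace H]
variable {K : Type*} [NormedAddCommGroup K] [InnerProductSpace ℂ K] [CompleteSpace K]

theorem inner_relativeOrientation (R₁ : Frame G G H) (R₂ : Frame G G K) {X : Set G}
    (hX : MeasurableSet X) (φ : H) (ψ : K) :
    ⟪tmul φ ψ, relativeOrientation R₁ R₂ X (tmul φ ψ)⟫_ℂ =
      ((((R₁.E.vectorMeasure φ).prod (R₂.E.vectorMeasure ψ)).map fun p => p.1⁻¹ * p.2).real X :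
        ℂ) := by
  have hf : Measurable fun p : G × G => p.1⁻¹ * p.2 := by fun_prop
  rw [relativeOrientation, isRelativization_relativization, Measure.real, Measure.map_apply hf hX,
    Measure.prod_apply (hf hX), ← integral_toReal
      (measurable_measure_prodMk_left (hf hX)).aemeasurable
      (Eventually.of_forall fun g => measure_lt_top _ _), ← integral_complex_ofReal]
  congr 1 with g
  have hfiber : R₂.E.vectorMeasure ψ (Prod.mk g ⁻¹' ((fun p => p.1⁻¹ * p.2) ⁻¹' X)) =
      R₂.E.vectorMeasure (R₂.U.op g⁻¹ ψ) X := by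
    rw [R₂.vectorMeasure_op, Measure.map_apply (measurable_const_smul g⁻¹) hX]
    rfl
  rw [R₂.U.inner_actObs, R₂.E.inner_toFun_self hX, hfiber, Measure.real]

theorem isBornMeasure_relativeOrientation (R₁ : Frame G G H) (R₂ : Frame G G K) {ω : State H}
    {ρ : State K} {μ ν : ProbabilityMeasure G} (hμ : IsBornMeasure R₁.E.toFun ω.op μ)
    (hν : IsBornMeasure R₂.E.toFun ρ.op ν) :
    IsBornMeasure (relativeOrientation R₁ R₂) (opTensor ω.op ρ.op) (relativeLaw μ ν) := by
  have hf : Measurable fun p : G × G => p.1⁻¹ * p.2 := by fun_prop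
  obtain ⟨v, hv⟩ := ω.exists_isEnsemble
  obtain ⟨t, ht, w, hw⟩ := ρ.exists_countable_isEnsemble
  have : Countable t := ht.to_subtype
  rw [hv.isBornMeasure_iff_eq_sum fun i X hX => R₁.E.inner_toFun_self hX (v i)] at hμ
  rw [hw.isBornMeasure_iff_eq_sum fun j X hX => R₂.E.inner_toFun_self hX (w j)] at hν
  rw [(isEnsemble_opTensor hv hw).isBornMeasure_iff_eq_sum fun p X hX =>
    inner_relativeOrientation R₁ R₂ hX (v p.1) (w p.2)]
  rw [relativeLaw, ProbabilityMeasure.toMeasure_map, ProbabilityMeasure.toMeasure_prod, hμ, hν,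
    Measure.prod_sum, Measure.map_sum hf.aemeasurable]

end Orientation

end QRF

theorem mainTheorem10_general
    {G : Type*} [Group G] [TopologicalSpace G] [IsTopologicalGroup G]
    [SecondCountableTopology G] [MeasurableSpace G] [BorelSpace G]
    {S₁ : Type*} [TopologicalSpace S₁] [MeasurableSpace S₁] [BorelSpace S₁] [MulAction G S₁]
    [ContinuousSMul G S₁] [MulAction.IsPretransitive G S₁]
    {S₂ : Type*} [TopologicalSpace S₂] [MeasurableSpace S₂] [BorelSpace S₂] [MulAction G S₂]
    [ContinuousSMul G S₂] [MulAction.IsPretransitive G S₂]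
    {H₁ : Type*} [NormedAddCommGroup H₁] [InnerProductSpace ℂ H₁] [CompleteSpace H₁]
    {H₂ : Type*} [NormedAddCommGroup H₂] [InnerProductSpace ℂ H₂] [CompleteSpace H₂]
    (R₁ : QRF.Frame G S₁ H₁) (R₂ : QRF.Frame G S₂ H₂)
    (hS₁ : QRF.IsPrincipalSpace G S₁) (hS₂ : QRF.IsPrincipalSpace G S₂)
    (x₁ : S₁) (x₂ : S₂)
    (ω : ℕ → QRF.State H₁) (ρ : ℕ → QRF.State H₂)
    (hω : QRF.IsLocalizingSequence R₁.E x₁ ω) (hρ : QRF.IsLocalizingSequence R₂.E x₂ ρ)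
    (h : G) :
    ∃ μ : ℕ × ℕ → ProbabilityMeasure G,
      (∀ n m : ℕ, QRF.IsBornMeasure
        (QRF.relativeOrientation (R₁.onGroup hS₁ x₁) (R₂.onGroup hS₂ x₂))
        (QRF.opTensor (ω n).op (R₂.U.actState h⁻¹ (ρ m).op)) (μ (n, m))) ∧
      Tendsto μ (atTop ×ˢ atTop) (𝓝 (diracProba h)) := by
  obtain ⟨μ, hμ, hμlim⟩ := hω.onGroup hS₁
  obtain ⟨ν, hν, hνlim⟩ := (hρ.onGroup hS₂).act h⁻¹
  have hborn := fun n m => QRF.isBornMeasure_relativeOrientation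
    (R₁.onGroup hS₁ x₁) (R₂.onGroup hS₂ x₂) (hμ n) (hν m)
  have hlim : Tendsto (fun p : ℕ × ℕ => QRF.relativeLaw (μ p.1) (ν p.2)) (atTop ×ˢ atTop)
      (𝓝 (QRF.relativeLaw (diracProba 1) (diracProba (h⁻¹⁻¹ • 1)))) :=
    (QRF.continuous_relativeLaw.tendsto _).comp
      ((hμlim.comp tendsto_fst).prodMk_nhds (hνlim.comp tendsto_snd))
  refine ⟨fun p => QRF.relativeLaw (μ p.1) (ν p.2), hborn, ?_⟩
  simpa only [QRF.relativeLaw_diracProba, inv_one, one_mul, inv_inv, smul_eq_mul, mul_one]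
    using hlim

theorem mainTheorem10
    {G : Type*} [Group G] [TopologicalSpace G] [IsTopologicalGroup G] [LocallyCompactSpace G]
    [SecondCountableTopology G] [T2Space G] [MeasurableSpace G] [BorelSpace G]
    {S₁ : Type*} [TopologicalSpace S₁] [MeasurableSpace S₁] [BorelSpace S₁] [MulAction G S₁]
    [ContinuousSMul G S₁] [MulAction.IsPretransitive G S₁]
    {S₂ : Type*} [TopologicalSpace S₂] [MeasurableSpace S₂] [BorelSpace S₂] [MulAction G S₂]
    [ContinuousSMul G S₂] [MulAction.IsPretransitive G S₂]
    {H₁ : Type*} [NormedAddCommGroup H₁] [InnerProductSpace ℂ H₁] [CompleteSpace H₁]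
    [TopologicalSpace.SeparableSpace H₁]
    {H₂ : Type*} [NormedAddCommGroup H₂] [InnerProductSpace ℂ H₂] [CompleteSpace H₂]
    [TopologicalSpace.SeparableSpace H₂]
    (R₁ : QRF.Frame G S₁ H₁) (R₂ : QRF.Frame G S₂ H₂)
    (hS₁ : QRF.IsPrincipalSpace G S₁) (hS₂ : QRF.IsPrincipalSpace G S₂)
    (hE₁ : R₁.E.IsLocalizable) (hE₂ : R₂.E.IsLocalizable)
    (x₁ : S₁) (x₂ : S₂)
    (ω : ℕ → QRF.State H₁) (ρ : ℕ → QRF.State H₂)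
    (hω : QRF.IsLocalizingSequence R₁.E x₁ ω) (hρ : QRF.IsLocalizingSequence R₂.E x₂ ρ)
    (h : G) :
    ∃ μ : ℕ × ℕ → ProbabilityMeasure G,
      (∀ n m : ℕ, QRF.IsBornMeasure
        (QRF.relativeOrientation (R₁.onGroup hS₁ x₁) (R₂.onGroup hS₂ x₂))
        (QRF.opTensor (ω n).op (R₂.U.actState h⁻¹ (ρ m).op)) (μ (n, m))) ∧
      Tendsto μ (atTop ×ˢ atTop) (𝓝 (diracProba h)) := by
  exact mainTheorem10_general R₁ R₂ hS₁ hS₂ x₁ x₂ ω ρ hω hρ h
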